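/- Setting. Let $G$ be a connected undirected graph on nodes $1,\dots,N$; $\mathscr V_i$ is the set of neighbors of $i$ and $V_i=|\mathscr V_i|$. Node $i$ holds $D_i=\{(x_i^n,y_i^n)\}_{n=1}^{B_i}$ with $x_i^n\in\mathbb R^d$, $\|x_i^n\|_2\le 1$, $y_i^n\in\{-1,1\}$. Let $0<C\le\min_i B_i$, $\rho>0$, $\eta>0$, $\gamma\ge 0$ with $2\eta V_i+\gamma>0$ for all $i$, let $K\ge 0$, let $\alpha_i(k)>0$ for $i\le N$, $1\le k\le K$, and put $$O(f,D_i)=\frac{C}{B_i}\sum_{n=1}^{B_i}\mathscr L(y_i^n f^Tx_i^n)+\frac{\rho}{N}R(f).$$ Assume that $\mathscr L:\mathbb R\to\mathbb R$ is strictly convex and twice differentiable with $|\mathscr L'|\le 1$ and $0<\mathscr L''\le c_1$, that $R:\mathbb R^d\to\mathbb R$ is $1$-strongly convex and twice continuously differentiable, and that $2c_1<\min_i\frac{B_i}{C}\left(\frac{\rho}{N}+2\eta V_i\right)$. Algorithm (private R-ADMM). The initial vectors $(f_i(0))_{i\le N}$ have an arbitrary law that does not depend on the data, and $\lambda_i(0)=0$.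 The noise vectors $\epsilon_i(2k-1)\in\mathbb R^d$, with density proportional to $\exp(-\alpha_i(k)\|\epsilon\|_2)$, are independent of each other and of the initial vectors. For $k=1,\dots,K$ and all $i$, $$f_i(2k-1)=\operatorname*{argmin}_{f}\Big\{O(f,D_i)+(2\lambda_i(2k-2)+\epsilon_i(2k-1))^Tf+\eta\sum_{j\in\mathscr V_i}\big\|\tfrac12(f_i(2k-2)+f_j(2k-2))-f\big\|_2^2\Big\},$$ $$\lambda_i(2k-1)=\lambda_i(2k-2)+\frac{\eta}{2}\sum_{j\in\mathscr V_i}(f_i(2k-1)-f_j(2k-1)),$$ $$f_i(2k)=f_i(2k-1)-\frac{1}{2\eta V_i+\gamma}\Big\{2\lambda_i(2k-1)+\epsilon_i(2k-1)+\nabla O(f_i(2k-1),D_i)+\eta\sum_{j\in\mathscr V_i}(f_i(2k-1)-f_j(2k-1))\Big\},$$ $$\lambda_i(2k)=\lambda_i(2k-1).$$ Theorem. Let $$\beta\ \ge\ \max_{1\le i\le N}\ \sum_{k=1}^{K}\frac{2C}{B_i}\left(\frac{1.4\,c_1}{\frac{\rho}{N}+2\eta V_i}+\alpha_i(k)\right).$$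 Then the algorithm is well defined (each argmin exists and is unique, and the output is a random variable) and satisfies $\beta$-differential privacy over the whole network and all $2K$ iterations: for any two collections of datasets $D_{all}=(D_i)_{i\le N}$ and $\hat D_{all}=(\hat D_i)_{i\le N}$ as above, with the same sizes $B_i$, that differ in at most one data point, and for every measurable set $S$ of possible outputs, $$\Pr\big(\{f_i(t)\}_{i\le N,\,0\le t\le 2K}\in S\mid D_{all}\big)\le e^{\beta}\,\Pr\big(\{f_i(t)\}_{i\le N,\,0\le t\le 2K}\in S\mid \hat D_{all}\big).$$ -/

import Mathlib

open MeasureTheory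

noncomputable section

namespace PrivateRADMM

/-- The space `ℝ^d` with its Euclidean norm. -/
abbrev Vec (d : ℕ) : Type := EuclideanSpace ℝ (Fin d)

/-- A sample: a feature vector in `ℝ^d` with a label in `{-1, 1}`. -/
@[ext]
structure Sample (d : ℕ) where
  feature : Vec d
  label : ℝ
  label_mem : label = 1 ∨ label = -1

/-- The data of a run: the network, the sizes `B i` of the local datasets, the constants
`C, ρ, η, γ`, the loss `L`, the regularizer `R`, and the noise parameters (`α i k` is used by
node `i` in the `k`-th odd iteration; `k` is counted from `0`). -/
structure Setup (N d K : ℕ) where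
  graph : SimpleGraph (Fin N)
  B : Fin N → ℕ
  C : ℝ
  ρ : ℝ
  η : ℝ
  γ : ℝ
  L : ℝ → ℝ
  R : Vec d → ℝ
  α : Fin N → Fin K → ℝ

/-- The union of all local datasets: the `n`-th sample of node `i` is `D i n`. -/
abbrev Dataset {N : ℕ} (d : ℕ) (B : Fin N → ℕ) : Type := (i : Fin N) → Fin (B i) → Sample d

/-- All feature vectors have norm at most `1`. -/
def Normalized {N d : ℕ} (B : Fin N → ℕ) : Set (Dataset d B) :=
  {D | ∀ i n, ‖(D i n).feature‖ ≤ 1}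

/-- Two datasets differ in at most one data point. -/
def Neighboring {N d : ℕ} {B : Fin N → ℕ} (D D' : Dataset d B) : Prop :=
  {p : (i : Fin N) × Fin (B i) | D p.1 p.2 ≠ D' p.1 p.2}.Subsingleton

/-- A point where `g` attains its global minimum (an arbitrary point if there is none). -/
def argmin {E : Type} [Inhabited E] (g : E → ℝ) : E :=
  Classical.epsilon fun u => ∀ w, g u ≤ g w

/-- The probability measure on `ℝ^d` with density proportional to `exp (-a * ‖ε‖)`. -/
def noiseLaw (d : ℕ) (a : ℝ) : Measure (Vec d) :=
  (volume : Measure (Vec d)).tilted fun ε => -a * ‖ε‖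

namespace Setup

variable {N d K : ℕ} (P : Setup N d K)

open scoped Classical in
/-- The set of neighbors of node `i`. -/
def nbrs (i : Fin N) : Finset (Fin N) := P.graph.neighborFinset i

/-- The number of neighbors of node `i`. -/
def V (i : Fin N) : ℕ := (P.nbrs i).card

/-- The local objective `O(f_i, D_i)` of node `i`. -/
def localObj (D : Dataset d P.B) (i : Fin N) (u : Vec d) : ℝ :=
  P.C / P.B i * ∑ n, P.L ((D i n).label * inner ℝ u (D i n).feature) + P.ρ / N * P.R u

/-- The perturbed objective of node `i` in an odd iteration, given the previous primal variables
`f`, the previous dual variable `l` of node `i`, and the noise vector `e` of node `i`. -/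
def privObj (D : Dataset d P.B) (i : Fin N) (f : Fin N → Vec d) (l e u : Vec d) : ℝ :=
  P.localObj D i u + inner ℝ ((2 : ℝ) • l + e) u
    + P.η * ∑ j ∈ P.nbrs i, ‖(1 / 2 : ℝ) • (f i + f j) - u‖ ^ 2

/-- The primal and dual variables of all nodes. -/
abbrev State (N d : ℕ) : Type := (Fin N → Vec d) × (Fin N → Vec d)

/-- The primal variables after an odd iteration with noise `e`. -/
def oddPrimal (D : Dataset d P.B) (e : Fin N → Vec d) (s : State N d) : Fin N → Vec d :=
  fun i => argmin (P.privObj D i s.1 (s.2 i) (e i))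

/-- An odd iteration with noise `e`. -/
def oddStep (D : Dataset d P.B) (e : Fin N → Vec d) (s : State N d) : State N d :=
  (P.oddPrimal D e s,
    fun i => s.2 i
      + (P.η / 2) • ∑ j ∈ P.nbrs i, (P.oddPrimal D e s i - P.oddPrimal D e s j))

/-- An even iteration; `e` is the noise of the preceding odd iteration. -/
def evenStep (D : Dataset d P.B) (e : Fin N → Vec d) (s : State N d) : State N d :=
  (fun i => s.1 i - (1 / (2 * P.η * P.V i + P.γ)) •
      ((2 : ℝ) • s.2 i + (e i + gradient (P.localObj D i) (s.1 i))
        + P.η • ∑ j ∈ P.nbrs i, (s.1 i - s.1 j)),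
    s.2)

/-- The state after `t` iterations, from the initial primal variables `f₀` and the initial dual
variables `0`, with noise `e k` in iteration `2 * k + 1` (reused in iteration `2 * k + 2`). -/
def state (D : Dataset d P.B) (f₀ : Fin N → Vec d) (e : ℕ → Fin N → Vec d) : ℕ → State N d
  | 0 => (f₀, 0)
  | t + 1 =>
    if Even t then P.oddStep D (e (t / 2)) (state D f₀ e t)
    else P.evenStep D (e (t / 2)) (state D f₀ e t)

/-- Everything exchanged in the `2 * K` iterations: the primal variables `f(0), …, f(2K)` of all
nodes. Only the noise vectors with index `k < K` enter. -/
def output (D : Dataset d P.B) (ω : (Fin N → Vec d) × (Fin K → Fin N → Vec d)) :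
    Fin (2 * K + 1) → Fin N → Vec d :=
  fun t => (P.state D ω.1 (fun k => if h : k < K then ω.2 ⟨k, h⟩ else 0) t).1

/-- The joint law of the initial primal variables (with law `μ₀`) and of the noise vectors, all
independent. -/
def randomness (μ₀ : Measure (Fin N → Vec d)) :
    Measure ((Fin N → Vec d) × (Fin K → Fin N → Vec d)) :=
  μ₀.prod (Measure.pi fun k => Measure.pi fun i => noiseLaw d (P.α i k))

/-- The law of everything exchanged in the `2 * K` iterations on the dataset `D`. -/
def outputLaw (μ₀ : Measure (Fin N → Vec d)) (D : Dataset d P.B) :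
    Measure (Fin (2 * K + 1) → Fin N → Vec d) :=
  (P.randomness μ₀).map (P.output D)

end Setup

/-- `β`-differential privacy of a randomized algorithm, given by the law `A D` of its output on
the dataset `D`, on a set of admissible datasets with a relation of being neighbors. -/
def DifferentiallyPrivate {X Y : Type} [MeasurableSpace Y] (admissible : Set X)
    (neighbor : X → X → Prop) (A : X → Measure Y) (β : ℝ) : Prop :=
  ∀ D ∈ admissible, ∀ D' ∈ admissible, neighbor D D' →
    ∀ S, MeasurableSet S → A D S ≤ ENNReal.ofReal (Real.exp β) * A D' S

end PrivateRADMM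

end

/-! ### The noise law and change of variables -/

noncomputable section

namespace PrivateRADMM

open Filter Topology

/-! Freeze all randomness except the noise ε of one node i in one round. Stationarity of the
strongly convex perturbed objective reads ε = c - g_D(u), where u is the new iterate, g_D is
`shiftedGrad` and c depends on the past only. Since g_D is bijective, u and ε determine each other,
and the other dataset produces the same u from the noise c - g_{D'}(u). Changing one sample moves
this noise by at most 2C/B_i and alters the Jacobian by rank-one terms. A change of variables then
bounds the ratio of probabilities by (1 + C c₁/(B_i m)) exp(2Cα/B_i), with m the convexity modulus
(`noiseLaw_le`).

The even iteration costs nothing: it sees data and noise only through ε + ∇O(u), which stationarity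
expresses by u and the past (`evenStep_oddStep_congr`). So runs with equal odd iterates in the
altered round agree throughout (`hybridState_congr`).

Composition over the rounds is a hybrid argument. In a hybrid run each round has its own dataset;
exchanging the dataset of one round costs one factor (`map_hybridOutput_le`), and the exponents add
up over the rounds (`map_mixture_le`). -/

lemma integrable_exp_neg_mul_norm {E : Type*} [NormedAddCommGroup E] [NormedSpace ℝ E]
    [FiniteDimensional ℝ E] [MeasurableSpace E] [BorelSpace E] (μ : Measure E)
    [μ.IsAddHaarMeasure] {a : ℝ} (ha : 0 < a) :
    Integrable (fun x : E => Real.exp (-a * ‖x‖)) μ := by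
  -- This exponent exceeds the dimension, so (1 + ‖x‖)^(-n) is integrable; the n-th Taylor term of
  -- exp shows that it dominates up to a constant.
  set n := Module.finrank ℝ E + 1 with hn
  have hint : Integrable (fun x : E => (1 + ‖x‖) ^ (-(n : ℝ))) μ :=
    integrable_one_add_norm (by simp [hn])
  refine (hint.const_mul ((n.factorial : ℝ) * Real.exp a / a ^ n)).mono'
    (by fun_prop) (Eventually.of_forall fun x => ?_)
  have h0 : 0 < 1 + ‖x‖ := by positivity
  have h1 := Real.pow_div_factorial_le_exp (a * (1 + ‖x‖)) (by positivity) n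
  rw [Real.norm_of_nonneg (Real.exp_pos _).le, Real.rpow_neg h0.le, Real.rpow_natCast,
    show -a * ‖x‖ = a - a * (1 + ‖x‖) by ring, Real.exp_sub]
  rw [div_le_iff₀ (by positivity), mul_pow] at h1
  rw [div_le_iff₀ (Real.exp_pos _)]
  have : (n.factorial : ℝ) * Real.exp a / a ^ n * ((1 + ‖x‖) ^ n)⁻¹ * Real.exp (a * (1 + ‖x‖))
      = Real.exp a * (Real.exp (a * (1 + ‖x‖)) * n.factorial / (a ^ n * (1 + ‖x‖) ^ n)) := by
    field_simp
  rw [this]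
  exact le_mul_of_one_le_right (Real.exp_pos _).le ((one_le_div (by positivity)).2 h1)

lemma isProbabilityMeasure_noiseLaw (d : ℕ) {a : ℝ} (ha : 0 < a) :
    IsProbabilityMeasure (noiseLaw d a) :=
  isProbabilityMeasure_tilted (integrable_exp_neg_mul_norm _ ha)

/-- If two bijective parametrizations of the noise space have comparable Jacobians and stay at
bounded distance, then events with the same preimage have comparable probabilities. -/
lemma noiseLaw_le_of_preimage_eq {d : ℕ} {a r δ : ℝ} (ha : 0 ≤ a) (hr : 0 ≤ r)
    {φ ψ : Vec d → Vec d} {φ' ψ' : Vec d → Vec d →L[ℝ] Vec d}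
    (hφ : Function.Bijective φ) (hψ : Function.Bijective ψ)
    (hφ' : ∀ u, HasFDerivAt φ (φ' u) u) (hψ' : ∀ u, HasFDerivAt ψ (ψ' u) u)
    (hdet : ∀ u, |(φ' u).det| ≤ r * |(ψ' u).det|) (hdist : ∀ u, ‖ψ u‖ ≤ ‖φ u‖ + δ)
    {X Y : Set (Vec d)} (hX : MeasurableSet X) (hXY : φ ⁻¹' X = ψ ⁻¹' Y) :
    noiseLaw d a X ≤ ENNReal.ofReal (r * Real.exp (a * δ)) * noiseLaw d a Y := by
  have hcont : Continuous φ := continuous_iff_continuousAt.2 fun u => (hφ' u).continuousAt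
  have hA : MeasurableSet (φ ⁻¹' X) := hcont.measurable hX
  have hX' : X = φ '' (φ ⁻¹' X) := (Set.image_preimage_eq X hφ.2).symm
  have hY' : Y = ψ '' (φ ⁻¹' X) := by rw [hXY, Set.image_preimage_eq Y hψ.2]
  -- Both events are images of the same parameter set, under φ and under ψ, so both probabilities
  -- become integrals over that set and the integrands can be compared pointwise.
  rw [hY', noiseLaw, tilted_apply, tilted_apply, ← hY',
    show (∫⁻ x in X, _ ∂(volume : Measure (Vec d))) = ∫⁻ x in φ '' (φ ⁻¹' X), _ ∂volume by rw [← hX'],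
    hY',
    lintegral_image_eq_lintegral_abs_det_fderiv_mul volume hA
      (fun u _ => (hφ' u).hasFDerivWithinAt) hφ.1.injOn,
    lintegral_image_eq_lintegral_abs_det_fderiv_mul volume hA
      (fun u _ => (hψ' u).hasFDerivWithinAt) hψ.1.injOn,
    ← lintegral_const_mul' _ _ ENNReal.ofReal_ne_top]
  refine lintegral_mono fun u => ?_
  rw [← ENNReal.ofReal_mul (abs_nonneg _), ← ENNReal.ofReal_mul (abs_nonneg _),
    ← ENNReal.ofReal_mul (by positivity)]
  refine ENNReal.ofReal_le_ofReal ?_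
  have hZ : 0 ≤ ∫ x : Vec d, Real.exp (-a * ‖x‖) := integral_nonneg fun _ => (Real.exp_pos _).le
  have hexp : Real.exp (-a * ‖φ u‖) ≤ Real.exp (a * δ) * Real.exp (-a * ‖ψ u‖) := by
    rw [← Real.exp_add]
    exact Real.exp_le_exp.2 (by nlinarith [hdist u])
  calc |(φ' u).det| * (Real.exp (-a * ‖φ u‖) / ∫ x : Vec d, Real.exp (-a * ‖x‖))
      ≤ (r * |(ψ' u).det|) * ((Real.exp (a * δ) * Real.exp (-a * ‖ψ u‖)) /
          ∫ x : Vec d, Real.exp (-a * ‖x‖)) := by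
        gcongr
        exact hdet u
    _ = _ := by ring

/-! ### Rank-one determinants and strong monotonicity -/

section Hilbert

variable {E : Type*} [NormedAddCommGroup E] [InnerProductSpace ℝ E]

/-- The operator `v ↦ ⟪x, v⟫ x`. -/
def outer (x : E) : E →L[ℝ] E := (innerSL ℝ x).smulRight x

lemma outer_apply (x v : E) : outer x v = inner ℝ x v • x := rfl

lemma inner_outer_nonneg (x v : E) : 0 ≤ inner ℝ (outer x v) v := by
  rw [outer_apply, real_inner_smul_left]
  exact mul_self_nonneg _

/-- The determinant of rank-one updates of a coercive operator. -/
lemma exists_det_add_smul_outer [FiniteDimensional ℝ E] {A : E →L[ℝ] E} {m : ℝ} (hm : 0 < m)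
    (hA : ∀ v, m * ‖v‖ ^ 2 ≤ inner ℝ (A v) v) {x : E} (hx : ‖x‖ ≤ 1) :
    ∃ t, 0 ≤ t ∧ t ≤ 1 / m ∧ ∀ a : ℝ, (A + a • outer x).det = A.det * (1 + a * t) := by
  have hinj : Function.Injective (A : E →ₗ[ℝ] E) := by
    refine (injective_iff_map_eq_zero _).2 fun v hv => ?_
    have h := hA v
    rw [show A v = 0 from hv, inner_zero_left] at h
    have : ‖v‖ ^ 2 ≤ 0 := nonpos_of_mul_nonpos_right h hm
    simpa using this
  -- With y = A⁻¹x, the witness is t = ⟪x, y⟫. Coercivity at y gives m‖y‖² ≤ ⟪x, y⟫ ≤ ‖y‖, hence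
  -- both bounds on t.
  obtain ⟨y, hy⟩ := LinearMap.injective_iff_surjective.1 hinj x
  have hy' : A y = x := hy
  have h1 := hA y
  rw [hy'] at h1
  have h2 : inner ℝ x y ≤ ‖y‖ := (real_inner_le_norm x y).trans
    (mul_le_of_le_one_left (norm_nonneg _) hx)
  have h3 : ‖y‖ ≤ 1 / m := by
    rw [le_div_iff₀ hm]
    by_contra! h
    have : 0 < ‖y‖ := by
      by_contra! h'
      nlinarith [norm_nonneg y]
    nlinarith
  refine ⟨inner ℝ x y, le_trans (by positivity) h1, h2.trans h3, fun a => ?_⟩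
  -- Factoring out A leaves the transvection v ↦ v + a⟪x, v⟫ y, of determinant 1 + a⟪x, y⟫.
  have hcomp : ((A + a • outer x : E →L[ℝ] E) : E →ₗ[ℝ] E)
      = (A : E →ₗ[ℝ] E) ∘ₗ LinearMap.transvection
          ((a • innerSL ℝ x : E →L[ℝ] ℝ) : E →ₗ[ℝ] ℝ) y := by
    ext v
    simp [LinearMap.transvection.apply, outer_apply, hy', smul_smul]
  rw [ContinuousLinearMap.det, hcomp, LinearMap.det_comp, LinearMap.transvection.det]
  simp [ContinuousLinearMap.det]

/-- The common factor det A cancels; the remaining factor is at most 1 + b/m on the left and at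
least 1 on the right. -/
lemma abs_det_add_smul_outer_le [FiniteDimensional ℝ E] {A : E →L[ℝ] E} {m : ℝ} (hm : 0 < m)
    (hA : ∀ v, m * ‖v‖ ^ 2 ≤ inner ℝ (A v) v) {x x' : E} (hx : ‖x‖ ≤ 1) (hx' : ‖x'‖ ≤ 1)
    {a a' b : ℝ} (ha : 0 ≤ a) (hab : a ≤ b) (ha' : 0 ≤ a') :
    |(A + a • outer x).det| ≤ (1 + b / m) * |(A + a' • outer x').det| := by
  obtain ⟨t, ht, htm, h⟩ := exists_det_add_smul_outer hm hA hx
  obtain ⟨t', ht', -, h'⟩ := exists_det_add_smul_outer hm hA hx'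
  rw [h, h', abs_mul, abs_mul, abs_of_nonneg (by positivity : 0 ≤ 1 + a * t),
    abs_of_nonneg (by positivity : 0 ≤ 1 + a' * t')]
  have h1 : a * t ≤ b / m := by
    rw [div_eq_mul_one_div]
    exact mul_le_mul hab htm ht (ha.trans hab)
  have h2 : 0 ≤ a' * t' := by positivity
  have h3 : 0 ≤ a * t := by positivity
  calc |A.det| * (1 + a * t) ≤ |A.det| * ((1 + b / m) * (1 + a' * t')) := by
        gcongr
        nlinarith
    _ = _ := by ring

/-- The right-hand side is the derivative at 0 of t ↦ ⟪g (u + t v), v⟫, whose right difference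
quotients are all at least m‖v‖². -/
lemma inner_fderiv_ge_of_strongly_monotone {g : E → E} {g' : E →L[ℝ] E} {m : ℝ} {u : E}
    (hg : HasFDerivAt g g' u) (hmono : ∀ w, m * ‖w - u‖ ^ 2 ≤ inner ℝ (g w - g u) (w - u))
    (v : E) : m * ‖v‖ ^ 2 ≤ inner ℝ (g' v) v := by
  have hline : HasDerivAt (fun t : ℝ => u + t • v) v 0 := by
    simpa using ((hasDerivAt_id (0 : ℝ)).smul_const v).const_add u
  have hd : HasDerivAt (fun t : ℝ => g (u + t • v)) (g' v) 0 :=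
    HasFDerivAt.comp_hasDerivAt (0 : ℝ) (by simpa using hg) hline
  have hi : HasDerivAt (fun t : ℝ => inner ℝ (g (u + t • v)) v) (inner ℝ (g' v) v) 0 := by
    simpa using hd.inner ℝ (hasDerivAt_const (0 : ℝ) v)
  refine ge_of_tendsto hi.tendsto_slope_zero_right ?_
  filter_upwards [self_mem_nhdsWithin] with t ht
  have ht : 0 < t := ht
  have h := hmono (u + t • v)
  rw [add_sub_cancel_left, norm_smul, Real.norm_of_nonneg ht.le, real_inner_smul_right] at h
  simp only [zero_add, zero_smul, add_zero, smul_eq_mul]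
  rw [← inner_sub_left, inv_mul_eq_div, le_div_iff₀ ht]
  nlinarith

end Hilbert

/-- Divide the convexity inequality on the segment from u to w by t and let t → 0⁺. It serves the
regularizer with m = 1 and the loss with m = 0. -/
lemma add_fderiv_le_of_strongConvexOn {E : Type*} [NormedAddCommGroup E] [NormedSpace ℝ E] {f : E → ℝ}
    {f' : E →L[ℝ] ℝ} {m : ℝ} {u : E} (hf : StrongConvexOn Set.univ m f) (hf' : HasFDerivAt f f' u)
    (w : E) : f u + f' (w - u) + m / 2 * ‖w - u‖ ^ 2 ≤ f w := by
  have hline : HasDerivAt (fun t : ℝ => u + t • (w - u)) (w - u) 0 := by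
    simpa using ((hasDerivAt_id (0 : ℝ)).smul_const (w - u)).const_add u
  have hd : HasDerivAt (fun t : ℝ => f (u + t • (w - u))) (f' (w - u)) 0 :=
    HasFDerivAt.comp_hasDerivAt (0 : ℝ) (by simpa using hf') hline
  have hlim : Tendsto (fun t : ℝ => f w - f u - (1 - t) * (m / 2 * ‖w - u‖ ^ 2)) (𝓝[>] 0)
      (𝓝 (f w - f u - (1 - 0) * (m / 2 * ‖w - u‖ ^ 2))) :=
    Tendsto.mono_left (Continuous.tendsto (by fun_prop) 0) nhdsWithin_le_nhds
  have := le_of_tendsto_of_tendsto hd.tendsto_slope_zero_right hlim ?_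
  · linarith
  filter_upwards [Ioo_mem_nhdsGT (zero_lt_one (α := ℝ))] with t ht
  have h := hf.2 (Set.mem_univ u) (Set.mem_univ w) (sub_nonneg.2 ht.2.le) ht.1.le (by ring)
  rw [show (1 - t) • u + t • w = u + t • (w - u) by module, norm_sub_rev] at h
  simp only [zero_add, zero_smul, add_zero, smul_eq_mul] at h ⊢
  rw [inv_mul_eq_div, div_le_iff₀ ht.1]
  nlinarith

end PrivateRADMM
end

/-! ### The perturbed objective and a single round -/

noncomputable section

namespace PrivateRADMM

open Filter Topology

namespace Setup

/-- The assumptions on the constants, the loss and the regularizer. -/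
structure Regular {N d K : ℕ} (P : Setup N d K) (c₁ : ℝ) : Prop where
  nodes : 0 < N
  C_pos : 0 < P.C
  C_le : ∀ i, P.C ≤ P.B i
  ρ_pos : 0 < P.ρ
  η_pos : 0 < P.η
  α_pos : ∀ i k, 0 < P.α i k
  loss_convex : StrictConvexOn ℝ Set.univ P.L
  loss_diff : Differentiable ℝ P.L
  loss_diff₂ : Differentiable ℝ (deriv P.L)
  abs_deriv_loss : ∀ z, |deriv P.L z| ≤ 1
  deriv₂_loss : ∀ z, 0 < deriv (deriv P.L) z ∧ deriv (deriv P.L) z ≤ c₁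
  reg_convex : StrongConvexOn Set.univ 1 P.R
  reg_smooth : ContDiff ℝ 2 P.R

variable {N d K : ℕ} (P : Setup N d K)

/-- The gradient of the local objective. -/
def localGrad (D : Dataset d P.B) (i : Fin N) (u : Vec d) : Vec d :=
  (P.C / P.B i) • ∑ n, (deriv P.L ((D i n).label * inner ℝ u (D i n).feature)
    * (D i n).label) • (D i n).feature + (P.ρ / N) • gradient P.R u

/-- The part of the gradient of the perturbed objective that depends on the point. -/
def shiftedGrad (D : Dataset d P.B) (i : Fin N) (u : Vec d) : Vec d :=
  P.localGrad D i u + (2 * P.η * P.V i) • u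

/-- The value of `shiftedGrad` at the minimizer of the perturbed objective without noise. -/
def target (i : Fin N) (f : Fin N → Vec d) (l : Vec d) : Vec d :=
  P.η • ∑ j ∈ P.nbrs i, (f i + f j) - (2 : ℝ) • l

/-- The convexity modulus of the perturbed objective of node `i`. -/
def modulus (i : Fin N) : ℝ := P.ρ / N + 2 * P.η * P.V i

/-- The Hessian of the local objective, shifted by that of the penalty. -/
def shiftedHess (D : Dataset d P.B) (i : Fin N) (u : Vec d) : Vec d →L[ℝ] Vec d :=
  (P.C / P.B i) • ∑ n, deriv (deriv P.L) ((D i n).label * inner ℝ u (D i n).feature) •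
      outer (D i n).feature
    + (P.ρ / N) • fderiv ℝ (gradient P.R) u
    + (2 * P.η * P.V i) • ContinuousLinearMap.id ℝ (Vec d)

variable {P} {c₁ : ℝ}

lemma _root_.PrivateRADMM.Sample.label_mul_self {d : ℕ} (z : Sample d) : z.label * z.label = 1 := by
  rcases z.label_mem with h | h <;> simp [h]

lemma _root_.PrivateRADMM.Sample.abs_label {d : ℕ} (z : Sample d) : |z.label| = 1 := by
  rcases z.label_mem with h | h <;> simp [h]

lemma continuous_target (i : Fin N) :
    Continuous fun p : (Fin N → Vec d) × Vec d => P.target i p.1 p.2 := by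
  unfold target
  fun_prop

namespace Regular

variable (hP : P.Regular c₁)
include hP

lemma modulus_pos (i : Fin N) : 0 < P.modulus i := by
  have := hP.nodes
  have := hP.ρ_pos
  have := hP.η_pos
  unfold modulus
  positivity

lemma B_pos (i : Fin N) : 0 < (P.B i : ℝ) := hP.C_pos.trans_le (hP.C_le i)

lemma hasGradientAt_reg (u : Vec d) : HasGradientAt P.R (gradient P.R u) u :=
  ((hP.reg_smooth.differentiable (by norm_num)) u).hasGradientAt

lemma reg_ge (u w : Vec d) :
    P.R u + inner ℝ (gradient P.R u) (w - u) + 1 / 2 * ‖w - u‖ ^ 2 ≤ P.R w :=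
  add_fderiv_le_of_strongConvexOn hP.reg_convex (hP.hasGradientAt_reg u).hasFDerivAt w

lemma loss_ge (a b : ℝ) : P.L a + deriv P.L a * (b - a) ≤ P.L b := by
  have h := add_fderiv_le_of_strongConvexOn (strongConvexOn_zero.2 hP.loss_convex.convexOn)
    (hP.loss_diff a).hasDerivAt.hasFDerivAt b
  simp at h
  linarith

lemma differentiable_gradient_reg : Differentiable ℝ (gradient P.R) := by
  have h : Differentiable ℝ (fderiv ℝ P.R) :=
    (hP.reg_smooth.fderiv_right (m := 1) (by norm_num)).differentiable (by norm_num)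
  exact (InnerProductSpace.toDual ℝ (Vec d)).symm.toContinuousLinearEquiv.differentiable.comp h

lemma hess_reg_ge (u v : Vec d) :
    1 * ‖v‖ ^ 2 ≤ inner ℝ (fderiv ℝ (gradient P.R) u v) v := by
  refine inner_fderiv_ge_of_strongly_monotone
    (hP.differentiable_gradient_reg u).hasFDerivAt (fun w => ?_) v
  have h1 := hP.reg_ge u w
  have h2 := hP.reg_ge w u
  rw [norm_sub_rev, ← neg_sub w u, inner_neg_right] at h2
  rw [inner_sub_left]
  linarith

lemma hasGradientAt_localObj (D : Dataset d P.B) (i : Fin N) (u : Vec d) :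
    HasGradientAt (P.localObj D i) (P.localGrad D i u) u := by
  rw [hasGradientAt_iff_hasFDerivAt]
  have hs : ∀ n, HasFDerivAt
      (fun u : Vec d => P.L ((D i n).label * inner ℝ u (D i n).feature))
      (deriv P.L ((D i n).label * inner ℝ u (D i n).feature) •
        ((D i n).label • innerSL ℝ (D i n).feature)) u := fun n => by
    have h1 : HasFDerivAt (fun u : Vec d => (D i n).label * inner ℝ u (D i n).feature)
        ((D i n).label • innerSL ℝ (D i n).feature) u := by
      have := ((innerSL ℝ (D i n).feature).hasFDerivAt (x := u)).const_mul (D i n).label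
      simpa [real_inner_comm] using this
    exact (hP.loss_diff _).hasDerivAt.comp_hasFDerivAt u h1
  have h := ((HasFDerivAt.fun_sum (u := Finset.univ) fun n _ => hs n).const_mul
    (P.C / P.B i)).add ((hP.hasGradientAt_reg u).hasFDerivAt.const_mul (P.ρ / N))
  refine h.congr_fderiv ?_
  ext v
  simp [localGrad, mul_assoc]

lemma gradient_localObj (D : Dataset d P.B) (i : Fin N) (u : Vec d) :
    gradient (P.localObj D i) u = P.localGrad D i u :=
  (hP.hasGradientAt_localObj D i u).gradient

lemma localObj_ge (D : Dataset d P.B) (i : Fin N) (u w : Vec d) :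
    P.localObj D i u + inner ℝ (P.localGrad D i u) (w - u) + P.ρ / N * (1 / 2 * ‖w - u‖ ^ 2)
      ≤ P.localObj D i w := by
  have h1 := mul_le_mul_of_nonneg_left (hP.reg_ge u w)
    (div_nonneg hP.ρ_pos.le (Nat.cast_nonneg N))
  have h2 : ∑ n, (P.L ((D i n).label * inner ℝ u (D i n).feature)
      + deriv P.L ((D i n).label * inner ℝ u (D i n).feature)
        * ((D i n).label * inner ℝ (D i n).feature (w - u)))
      ≤ ∑ n, P.L ((D i n).label * inner ℝ w (D i n).feature) := by
    refine Finset.sum_le_sum fun n _ => ?_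
    refine le_trans (le_of_eq ?_)
      (hP.loss_ge ((D i n).label * inner ℝ u (D i n).feature) _)
    rw [inner_sub_right, real_inner_comm w, real_inner_comm u]
    ring
  have h3 := mul_le_mul_of_nonneg_left h2 (div_nonneg hP.C_pos.le (hP.B_pos i).le)
  rw [Finset.sum_add_distrib] at h3
  simp only [localObj, localGrad, inner_add_left, real_inner_smul_left, sum_inner, mul_assoc]
    at h1 h3 ⊢
  linarith

/-- The penalty is exactly quadratic, so its expansion at u adds 2ηV to the modulus ρ/N of the local
objective. Coercivity, sufficiency of stationarity and strong monotonicity all follow from this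
bound. -/
lemma privObj_ge (D : Dataset d P.B) (i : Fin N) (f : Fin N → Vec d) (l e u w : Vec d) :
    P.privObj D i f l e u
      + inner ℝ (P.shiftedGrad D i u - (P.target i f l - e)) (w - u)
      + P.modulus i / 2 * ‖w - u‖ ^ 2 ≤ P.privObj D i f l e w := by
  have hq : ∀ j, ‖(1 / 2 : ℝ) • (f i + f j) - w‖ ^ 2
      = ‖(1 / 2 : ℝ) • (f i + f j) - u‖ ^ 2
        + (2 * inner ℝ u (w - u) - inner ℝ (f i + f j) (w - u)) + ‖w - u‖ ^ 2 := fun j => by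
    rw [show (1 / 2 : ℝ) • (f i + f j) - w = ((1 / 2 : ℝ) • (f i + f j) - u) - (w - u) by abel,
      norm_sub_sq_real, inner_sub_left, real_inner_smul_left]
    ring
  have h := hP.localObj_ge D i u w
  have hl : inner ℝ ((2 : ℝ) • l + e) w
      = inner ℝ ((2 : ℝ) • l + e) u + inner ℝ ((2 : ℝ) • l + e) (w - u) := by
    rw [← inner_add_right]; congr 1; abel
  unfold privObj
  rw [hl, Finset.sum_congr rfl fun j _ => hq j]
  simp only [shiftedGrad, target, modulus, V, inner_add_left, inner_sub_left, real_inner_smul_left,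
    sum_inner, Finset.sum_add_distrib, Finset.sum_sub_distrib, Finset.sum_const,
    ← Nat.cast_smul_eq_nsmul ℝ, smul_eq_mul] at h ⊢
  linarith

lemma hasGradientAt_privObj (D : Dataset d P.B) (i : Fin N) (f : Fin N → Vec d) (l e u : Vec d) :
    HasGradientAt (P.privObj D i f l e) (P.shiftedGrad D i u - (P.target i f l - e)) u := by
  rw [hasGradientAt_iff_hasFDerivAt]
  have hq : ∀ j, HasFDerivAt (fun u : Vec d => ‖(1 / 2 : ℝ) • (f i + f j) - u‖ ^ 2)
      (innerSL ℝ ((2 : ℝ) • u - (f i + f j))) u := fun j => by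
    have h := ((hasFDerivAt_id (𝕜 := ℝ) u).const_sub ((1 / 2 : ℝ) • (f i + f j))).norm_sq
    refine h.congr_fderiv ?_
    ext v
    simp
    ring
  have h := ((hP.hasGradientAt_localObj D i u).hasFDerivAt.add
    ((innerSL ℝ ((2 : ℝ) • l + e)).hasFDerivAt (x := u))).add
    ((HasFDerivAt.fun_sum (u := P.nbrs i) fun j _ => hq j).const_mul P.η)
  refine h.congr_fderiv ?_
  ext v
  simp [shiftedGrad, target, V, Finset.sum_add_distrib]
  ring

lemma hasFDerivAt_shiftedGrad (D : Dataset d P.B) (i : Fin N) (u : Vec d) :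
    HasFDerivAt (P.shiftedGrad D i) (P.shiftedHess D i u) u := by
  have hs : ∀ n, HasFDerivAt
      (fun u : Vec d => (deriv P.L ((D i n).label * inner ℝ u (D i n).feature)
        * (D i n).label) • (D i n).feature)
      (deriv (deriv P.L) ((D i n).label * inner ℝ u (D i n).feature) •
        outer (D i n).feature) u := fun n => by
    have h1 : HasFDerivAt (fun u : Vec d => (D i n).label * inner ℝ u (D i n).feature)
        ((D i n).label • innerSL ℝ (D i n).feature) u := by
      have := ((innerSL ℝ (D i n).feature).hasFDerivAt (x := u)).const_mul (D i n).label
      simpa [real_inner_comm] using this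
    have h2 := (((hP.loss_diff₂ _).hasDerivAt.comp_hasFDerivAt u h1).mul_const
      (D i n).label).smul_const (D i n).feature
    refine h2.congr_fderiv ?_
    ext1 v
    simp only [outer_apply, ContinuousLinearMap.smulRight_apply, smul_apply,
      innerSL_apply_apply, smul_smul, smul_eq_mul]
    congr 1
    linear_combination (deriv (deriv P.L) ((D i n).label * inner ℝ u (D i n).feature) *
      inner ℝ (D i n).feature v) * (D i n).label_mul_self
  exact (((HasFDerivAt.fun_sum (u := Finset.univ) fun n _ => hs n).const_smul
    (P.C / P.B i)).add ((hP.differentiable_gradient_reg u).hasFDerivAt.const_smul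
      (P.ρ / N))).add ((hasFDerivAt_id u).const_smul (2 * P.η * P.V i))

lemma continuous_shiftedGrad (D : Dataset d P.B) (i : Fin N) : Continuous (P.shiftedGrad D i) :=
  continuous_iff_continuousAt.2 fun u => (hP.hasFDerivAt_shiftedGrad D i u).continuousAt

lemma shiftedGrad_strongly_monotone (D : Dataset d P.B) (i : Fin N) (u w : Vec d) :
    P.modulus i * ‖w - u‖ ^ 2
      ≤ inner ℝ (P.shiftedGrad D i w - P.shiftedGrad D i u) (w - u) := by
  -- The terms from f, l and e cancel when the two bounds are added, so zero is as good as any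
  -- choice.
  have h1 := hP.privObj_ge D i 0 0 0 u w
  have h2 := hP.privObj_ge D i 0 0 0 w u
  rw [norm_sub_rev, ← neg_sub w u, inner_neg_right] at h2
  simp only [inner_sub_left] at h1 h2 ⊢
  linarith

/-- Cauchy–Schwarz applied to strong monotonicity; this yields injectivity and a Lipschitz inverse.
-/
lemma norm_sub_le_shiftedGrad (D : Dataset d P.B) (i : Fin N) (u w : Vec d) :
    ‖w - u‖ ≤ (P.modulus i)⁻¹ * ‖P.shiftedGrad D i w - P.shiftedGrad D i u‖ := by
  have h := (hP.shiftedGrad_strongly_monotone D i u w).trans (real_inner_le_norm _ _)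
  have hm := hP.modulus_pos i
  rw [← div_eq_inv_mul, le_div_iff₀ hm]
  rcases (norm_nonneg (w - u)).eq_or_lt with h0 | h0
  · rw [← h0]; simp
  · nlinarith

lemma exists_privObj_minimizer (D : Dataset d P.B) (i : Fin N) (f : Fin N → Vec d)
    (l e : Vec d) : ∃ u, ∀ w, P.privObj D i f l e u ≤ P.privObj D i f l e w := by
  have hcont : Continuous (P.privObj D i f l e) := continuous_iff_continuousAt.2 fun u =>
    (hP.hasGradientAt_privObj D i f l e u).hasFDerivAt.continuousAt
  refine hcont.exists_forall_le ?_
  set a := P.privObj D i f l e 0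
  set g := P.shiftedGrad D i 0 - (P.target i f l - e)
  have hm := hP.modulus_pos i
  have hlim : Tendsto (fun t : ℝ => a + t * (P.modulus i / 2 * t - ‖g‖)) atTop atTop :=
    tendsto_atTop_add_const_left _ _ (tendsto_id.atTop_mul_atTop₀
      (tendsto_atTop_add_const_right _ _ (tendsto_id.const_mul_atTop (by positivity))))
  refine tendsto_atTop_mono (fun w => ?_) (hlim.comp (tendsto_norm_cocompact_atTop (E := Vec d)))
  have h := hP.privObj_ge D i f l e 0 w
  have h' := neg_le_of_abs_le (abs_real_inner_le_norm g w)
  rw [sub_zero] at h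
  simp only [Function.comp_apply]
  nlinarith

lemma minimizer_iff (D : Dataset d P.B) (i : Fin N) (f : Fin N → Vec d) (l e u : Vec d) :
    (∀ w, P.privObj D i f l e u ≤ P.privObj D i f l e w)
      ↔ P.shiftedGrad D i u = P.target i f l - e := by
  constructor
  · intro h
    have h0 := IsLocalMin.hasFDerivAt_eq_zero (Filter.Eventually.of_forall h)
      (hP.hasGradientAt_privObj D i f l e u).hasFDerivAt
    rwa [map_eq_zero_iff _ (LinearIsometryEquiv.injective _), sub_eq_zero] at h0
  · intro h w
    have h1 := hP.privObj_ge D i f l e u w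
    rw [h, sub_self, inner_zero_left] at h1
    have := hP.modulus_pos i
    have : 0 ≤ P.modulus i / 2 * ‖w - u‖ ^ 2 := by positivity
    linarith

lemma shiftedGrad_bijective (D : Dataset d P.B) (i : Fin N) :
    Function.Bijective (P.shiftedGrad D i) := by
  constructor
  · intro w u h
    have := hP.norm_sub_le_shiftedGrad D i u w
    rw [h, sub_self, norm_zero, mul_zero] at this
    exact sub_eq_zero.1 (norm_le_zero_iff.1 this)
  · intro y
    -- For f = l = 0 the target vanishes, so the stationarity condition with noise -y is
    -- `shiftedGrad` = y.
    obtain ⟨u, hu⟩ := hP.exists_privObj_minimizer D i 0 0 (-y)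
    exact ⟨u, by simpa [target] using (hP.minimizer_iff D i 0 0 (-y) u).1 hu⟩

lemma existsUnique_minimizer (D : Dataset d P.B) (i : Fin N) (f : Fin N → Vec d) (l e : Vec d) :
    ∃! u, ∀ w, P.privObj D i f l e u ≤ P.privObj D i f l e w := by
  simp_rw [hP.minimizer_iff]
  exact (hP.shiftedGrad_bijective D i).existsUnique _

/-- This makes the odd update invertible in the noise: the only noise of node i that leads to u is
target minus `shiftedGrad` at u. -/
lemma oddPrimal_eq_iff (D : Dataset d P.B) (e : Fin N → Vec d) (s : State N d) (i : Fin N)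
    (u : Vec d) : P.oddPrimal D e s i = u
      ↔ P.shiftedGrad D i u = P.target i s.1 (s.2 i) - e i := by
  have h : P.shiftedGrad D i (P.oddPrimal D e s i) = P.target i s.1 (s.2 i) - e i :=
    (hP.minimizer_iff _ _ _ _ _ _).1
      (Classical.epsilon_spec (hP.exists_privObj_minimizer D i s.1 (s.2 i) (e i)))
  constructor
  · rintro rfl; exact h
  · intro hu; exact (hP.shiftedGrad_bijective D i).1 (h.trans hu.symm)

lemma shiftedGrad_oddPrimal (D : Dataset d P.B) (e : Fin N → Vec d) (s : State N d) (i : Fin N) :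
    P.shiftedGrad D i (P.oddPrimal D e s i) = P.target i s.1 (s.2 i) - e i :=
  (hP.oddPrimal_eq_iff D e s i _).1 rfl

lemma continuous_oddPrimal (D : Dataset d P.B) :
    Continuous fun p : (Fin N → Vec d) × State N d => P.oddPrimal D p.1 p.2 := by
  refine continuous_pi fun i => ?_
  obtain ⟨G, hG⟩ := (hP.shiftedGrad_bijective D i).surjective.hasRightInverse
  have hinv : Continuous G := by
    refine (LipschitzWith.of_dist_le_mul (K := ⟨_, (inv_pos.2 (hP.modulus_pos i)).le⟩)
      fun a b => ?_).continuous
    have h := hP.norm_sub_le_shiftedGrad D i (G b) (G a)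
    rwa [hG, hG, ← dist_eq_norm, ← dist_eq_norm] at h
  have heq : (fun p : (Fin N → Vec d) × State N d => P.oddPrimal D p.1 p.2 i)
      = fun p => G (P.target i p.2.1 (p.2.2 i) - p.1 i) := by
    funext p
    exact (hP.oddPrimal_eq_iff ..).2 (hG _)
  rw [heq]
  refine hinv.comp (Continuous.sub ?_ (by fun_prop))
  exact (continuous_target i).comp
    (f := fun p : (Fin N → Vec d) × State N d => (p.2.1, p.2.2 i)) (by fun_prop)

lemma continuous_oddStep (D : Dataset d P.B) :
    Continuous fun p : (Fin N → Vec d) × State N d => P.oddStep D p.1 p.2 := by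
  have h := hP.continuous_oddPrimal D
  have h' : ∀ i, Continuous fun p : (Fin N → Vec d) × State N d => P.oddPrimal D p.1 p.2 i :=
    fun i => (continuous_apply i).comp h
  unfold oddStep
  exact h.prodMk (continuous_pi fun i => by fun_prop)

lemma continuous_evenStep (D : Dataset d P.B) :
    Continuous fun p : (Fin N → Vec d) × State N d => P.evenStep D p.1 p.2 := by
  have h : ∀ i, Continuous (P.localGrad D i) := fun i => by
    have := (hP.continuous_shiftedGrad D i).sub (continuous_const_smul (2 * P.η * P.V i))
    refine this.congr fun u => ?_
    simp [shiftedGrad]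
  unfold evenStep
  simp_rw [hP.gradient_localObj]
  have h' : ∀ i, Continuous fun p : (Fin N → Vec d) × State N d => P.localGrad D i (p.2.1 i) :=
    fun i => (h i).comp (f := fun p : (Fin N → Vec d) × State N d => p.2.1 i) (by fun_prop)
  fun_prop

/-- Given the state before a round and the primal variables after its odd iteration, the even
iteration uses neither the data nor the noise. -/
lemma evenStep_oddStep_congr {D D' : Dataset d P.B} {e e' : Fin N → Vec d} {s : State N d}
    (h : P.oddPrimal D e s = P.oddPrimal D' e' s) :
    P.evenStep D e (P.oddStep D e s) = P.evenStep D' e' (P.oddStep D' e' s) := by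
  -- By stationarity both sides equal the target minus 2ηV times the common iterate.
  have hgrad : ∀ i, e i + P.localGrad D i (P.oddPrimal D' e' s i)
      = e' i + P.localGrad D' i (P.oddPrimal D' e' s i) := fun i => by
    have h1 := hP.shiftedGrad_oddPrimal D e s i
    have h2 := hP.shiftedGrad_oddPrimal D' e' s i
    rw [h] at h1
    simp only [shiftedGrad] at h1 h2
    rw [← eq_sub_iff_add_eq] at h1 h2
    rw [h1, h2]
    abel
  unfold evenStep oddStep
  simp_rw [hP.gradient_localObj, h, hgrad]

end Regular
end Setup
end PrivateRADMM
end

/-! ### Product measures, hybrid runs and the loss of one round -/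

noncomputable section

namespace PrivateRADMM

lemma lintegral_pi_le_of_update {ι : Type*} [Fintype ι] [DecidableEq ι] {X : ι → Type*}
    [∀ i, MeasurableSpace (X i)] (μ : ∀ i, Measure (X i)) [∀ i, SigmaFinite (μ i)] (i : ι)
    {f g : (∀ i, X i) → ENNReal} (hf : Measurable f) (hg : Measurable g)
    (h : ∀ w, ∫⁻ x, f (Function.update w i x) ∂μ i ≤ ∫⁻ x, g (Function.update w i x) ∂μ i) :
    ∫⁻ w, f w ∂Measure.pi μ ≤ ∫⁻ w, g w ∂Measure.pi μ := by
  refine lintegral_le_of_lmarginal_le {i} hf hg ?_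
  rw [lmarginal_singleton, lmarginal_singleton]
  exact h

/-- A comparison of all sections of two events in one coordinate of a product of products gives a
comparison of their probabilities. -/
lemma pi_pi_le_of_update {ι κ E : Type*} [Fintype ι] [DecidableEq ι] [Fintype κ] [DecidableEq κ]
    [MeasurableSpace E] (μ : ι → κ → Measure E) [∀ i j, SigmaFinite (μ i j)] (i : ι) (j : κ)
    {A A' : Set (ι → κ → E)} (hA : MeasurableSet A) (hA' : MeasurableSet A') (c : ENNReal)
    (h : ∀ w : ι → κ → E, μ i j {x | Function.update w i (Function.update (w i) j x) ∈ A}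
      ≤ c * μ i j {x | Function.update w i (Function.update (w i) j x) ∈ A'}) :
    Measure.pi (fun i => Measure.pi (μ i)) A ≤ c * Measure.pi (fun i => Measure.pi (μ i)) A' := by
  have hm : ∀ {B : Set (ι → κ → E)}, MeasurableSet B →
      Measurable (B.indicator (1 : (ι → κ → E) → ENNReal)) := fun hB => measurable_one.indicator hB
  rw [← lintegral_indicator_one hA, ← lintegral_indicator_one hA',
    ← lintegral_const_mul c (hm hA')]
  refine lintegral_pi_le_of_update _ i (hm hA) ((hm hA').const_mul c) fun w => ?_
  refine lintegral_pi_le_of_update _ j ((hm hA).comp (measurable_update w))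
    (((hm hA').const_mul c).comp (measurable_update w)) fun y => ?_
  have hupd : Measurable fun x => Function.update w i (Function.update y j x) :=
    (measurable_update w).comp (measurable_update y)
  have hsec : ∀ {B : Set (ι → κ → E)}, MeasurableSet B →
      ∫⁻ x, B.indicator (1 : (ι → κ → E) → ENNReal)
        (Function.update w i (Function.update y j x)) ∂μ i j
      = μ i j {x | Function.update w i (Function.update y j x) ∈ B} := fun hB =>
    lintegral_indicator_one (hupd hB)
  have := h (Function.update w i y)
  simp only [Function.update_idem, Function.update_self] at this
  rw [lintegral_const_mul c (f := fun x => A'.indicator (1 : (ι → κ → E) → ENNReal)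
    (Function.update w i (Function.update y j x))) ((hm hA').comp hupd), hsec hA, hsec hA']
  exact this

namespace Setup

variable {N d K : ℕ} (P : Setup N d K)

/-- The states of the algorithm if the dataset `D k` is used in the iterations `2 * k + 1` and
`2 * k + 2`. -/
def hybridState (D : ℕ → Dataset d P.B) (f₀ : Fin N → Vec d) (e : ℕ → Fin N → Vec d) :
    ℕ → State N d
  | 0 => (f₀, 0)
  | t + 1 =>
    if Even t then P.oddStep (D (t / 2)) (e (t / 2)) (hybridState D f₀ e t)
    else P.evenStep (D (t / 2)) (e (t / 2)) (hybridState D f₀ e t)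

/-- A finite noise sequence, continued by zero. -/
def extendNoise (w : Fin K → Fin N → Vec d) : ℕ → Fin N → Vec d :=
  fun k => if h : k < K then w ⟨k, h⟩ else 0

/-- The output of the algorithm if the dataset `D k` is used in the iterations `2 * k + 1` and
`2 * k + 2`. -/
def hybridOutput (D : ℕ → Dataset d P.B) (ω : (Fin N → Vec d) × (Fin K → Fin N → Vec d)) :
    Fin (2 * K + 1) → Fin N → Vec d :=
  fun t => (P.hybridState D ω.1 (extendNoise ω.2) t).1

/-- The per-iteration privacy loss caused by the data of node `i`. -/
def roundLoss (c₁ : ℝ) (i : Fin N) (k : Fin K) : ℝ :=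
  2 * P.C / P.B i * (1.4 * c₁ / P.modulus i + P.α i k)

/-- The shifted Hessian without the contribution of one sample. -/
def shiftedHessErase (D : Dataset d P.B) (i : Fin N) (n₀ : Fin (P.B i)) (u : Vec d) :
    Vec d →L[ℝ] Vec d :=
  (P.C / P.B i) • ∑ n ∈ Finset.univ.erase n₀,
      deriv (deriv P.L) ((D i n).label * inner ℝ u (D i n).feature) • outer (D i n).feature
    + (P.ρ / N) • fderiv ℝ (gradient P.R) u
    + (2 * P.η * P.V i) • ContinuousLinearMap.id ℝ (Vec d)

variable {P}

lemma shiftedHess_eq_erase_add (D : Dataset d P.B) (i : Fin N) (n₀ : Fin (P.B i)) (u : Vec d) :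
    P.shiftedHess D i u = P.shiftedHessErase D i n₀ u
      + (P.C / P.B i * deriv (deriv P.L) ((D i n₀).label * inner ℝ u (D i n₀).feature)) •
        outer (D i n₀).feature := by
  rw [shiftedHess, shiftedHessErase, ← Finset.add_sum_erase _ _ (Finset.mem_univ n₀), smul_add,
    smul_smul]
  abel

lemma hybridState_const (D : Dataset d P.B) (f₀ : Fin N → Vec d) (e : ℕ → Fin N → Vec d) (t : ℕ) :
    P.hybridState (fun _ => D) f₀ e t = P.state D f₀ e t := by
  induction t with
  | zero => rfl
  | succ t ih => rw [hybridState, state, ih]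

lemma hybridOutput_const (D : Dataset d P.B) : P.hybridOutput (fun _ => D) = P.output D := by
  funext ω t
  exact congrArg Prod.fst (hybridState_const D ω.1 _ t)

lemma hybridState_congr_of_lt {D D' : ℕ → Dataset d P.B} {f₀ : Fin N → Vec d}
    {e e' : ℕ → Fin N → Vec d} {m : ℕ} (hD : ∀ k < m, D k = D' k) (he : ∀ k < m, e k = e' k)
    {t : ℕ} (ht : t ≤ 2 * m) : P.hybridState D f₀ e t = P.hybridState D' f₀ e' t := by
  induction t with
  | zero => rfl
  | succ t ih =>
    rw [hybridState, hybridState, ih (by omega), hD (t / 2) (by omega), he (t / 2) (by omega)]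

namespace Regular

variable {c₁ : ℝ} (hP : P.Regular c₁)
include hP

/-- The modulus comes from the regularizer and the penalty alone; the remaining samples contribute
positive semidefinite terms. -/
lemma shiftedHessErase_ge (D : Dataset d P.B) (i : Fin N) (n₀ : Fin (P.B i)) (u v : Vec d) :
    P.modulus i * ‖v‖ ^ 2 ≤ inner ℝ (P.shiftedHessErase D i n₀ u v) v := by
  have h1 := mul_le_mul_of_nonneg_left (hP.hess_reg_ge u v)
    (div_nonneg hP.ρ_pos.le (Nat.cast_nonneg N))
  have h2 : 0 ≤ P.C / P.B i * ∑ n ∈ Finset.univ.erase n₀,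
      deriv (deriv P.L) ((D i n).label * inner ℝ u (D i n).feature)
        * inner ℝ (outer (D i n).feature v) v :=
    mul_nonneg (div_nonneg hP.C_pos.le (hP.B_pos i).le) (Finset.sum_nonneg fun n _ =>
      mul_nonneg (hP.deriv₂_loss _).1.le (inner_outer_nonneg _ _))
  simp only [shiftedHessErase, modulus, add_apply, smul_apply, sum_apply,
    ContinuousLinearMap.id_apply, inner_add_left, real_inner_smul_left, sum_inner,
    real_inner_self_eq_norm_sq] at h1 h2 ⊢
  linarith

/-- Without sample n₀ the two Hessians coincide, so both are nonnegative rank-one updates of one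
coercive operator. -/
lemma abs_det_shiftedHess_le {D D' : Dataset d P.B} (hD : D ∈ Normalized P.B)
    (hD' : D' ∈ Normalized P.B) {i : Fin N} {n₀ : Fin (P.B i)}
    (h : ∀ n ≠ n₀, D i n = D' i n) (u : Vec d) :
    |(P.shiftedHess D i u).det|
      ≤ (1 + P.C / P.B i * c₁ / P.modulus i) * |(P.shiftedHess D' i u).det| := by
  have hCB : 0 ≤ P.C / P.B i := div_nonneg hP.C_pos.le (hP.B_pos i).le
  have herase : P.shiftedHessErase D i n₀ u = P.shiftedHessErase D' i n₀ u := by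
    unfold shiftedHessErase
    rw [Finset.sum_congr rfl fun n hn => by rw [h n (Finset.ne_of_mem_erase hn)]]
  rw [shiftedHess_eq_erase_add D i n₀, shiftedHess_eq_erase_add D' i n₀, herase]
  exact abs_det_add_smul_outer_le (hP.modulus_pos i) (hP.shiftedHessErase_ge D' i n₀ u)
    (hD i n₀) (hD' i n₀) (mul_nonneg hCB (hP.deriv₂_loss _).1.le)
    (mul_le_mul_of_nonneg_left (hP.deriv₂_loss _).2 hCB)
    (mul_nonneg hCB (hP.deriv₂_loss _).1.le)

lemma norm_shiftedGrad_sub_le {D D' : Dataset d P.B} (hD : D ∈ Normalized P.B)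
    (hD' : D' ∈ Normalized P.B) {i : Fin N} {n₀ : Fin (P.B i)}
    (h : ∀ n ≠ n₀, D i n = D' i n) (u : Vec d) :
    ‖P.shiftedGrad D i u - P.shiftedGrad D' i u‖ ≤ 2 * P.C / P.B i := by
  have hCB : 0 ≤ P.C / P.B i := div_nonneg hP.C_pos.le (hP.B_pos i).le
  have hterm : ∀ z : Sample d, ‖z.feature‖ ≤ 1 →
      ‖(deriv P.L (z.label * inner ℝ u z.feature) * z.label) • z.feature‖ ≤ 1 := fun z hz => by
    rw [norm_smul, Real.norm_eq_abs, abs_mul, z.abs_label, mul_one]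
    exact mul_le_one₀ (hP.abs_deriv_loss _) (norm_nonneg _) hz
  have hdiff : P.shiftedGrad D i u - P.shiftedGrad D' i u = (P.C / P.B i) •
      ((deriv P.L ((D i n₀).label * inner ℝ u (D i n₀).feature) * (D i n₀).label) •
          (D i n₀).feature
        - (deriv P.L ((D' i n₀).label * inner ℝ u (D' i n₀).feature) * (D' i n₀).label) •
          (D' i n₀).feature) := by
    unfold shiftedGrad localGrad
    rw [← Finset.add_sum_erase _ _ (Finset.mem_univ n₀),
      ← Finset.add_sum_erase (Finset.univ : Finset (Fin (P.B i))) (fun n =>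
        (deriv P.L ((D' i n).label * inner ℝ u (D' i n).feature) * (D' i n).label) •
          (D' i n).feature) (Finset.mem_univ n₀),
      Finset.sum_congr rfl fun n hn => by rw [h n (Finset.ne_of_mem_erase hn)]]
    module
  rw [hdiff, norm_smul, Real.norm_of_nonneg hCB, mul_comm 2, mul_div_right_comm]
  refine mul_le_mul_of_nonneg_left ((norm_sub_le _ _).trans ?_) hCB
  linarith [hterm _ (hD i n₀), hterm _ (hD' i n₀)]

/-- The privacy loss of one node in one odd iteration. -/
lemma noiseLaw_le {D D' : Dataset d P.B} (hD : D ∈ Normalized P.B) (hD' : D' ∈ Normalized P.B)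
    {i : Fin N} {n₀ : Fin (P.B i)} (h : ∀ n ≠ n₀, D i n = D' i n) (k : Fin K) (c : Vec d)
    {X Y : Set (Vec d)} (hX : MeasurableSet X)
    (hXY : ∀ u, c - P.shiftedGrad D i u ∈ X ↔ c - P.shiftedGrad D' i u ∈ Y) :
    noiseLaw d (P.α i k) X
      ≤ ENNReal.ofReal (Real.exp (P.roundLoss c₁ i k)) * noiseLaw d (P.α i k) Y := by
  have hc₁ : 0 ≤ c₁ := (hP.deriv₂_loss 0).1.le.trans (hP.deriv₂_loss 0).2
  have hm := hP.modulus_pos i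
  have hB := hP.B_pos i
  have hC := hP.C_pos
  have hbij : ∀ D, Function.Bijective fun u => c - P.shiftedGrad D i u := fun D =>
    (Equiv.subLeft c).bijective.comp (hP.shiftedGrad_bijective D i)
  have hder : ∀ D u, HasFDerivAt (fun u => c - P.shiftedGrad D i u) (-P.shiftedHess D i u) u :=
    fun D u => (hP.hasFDerivAt_shiftedGrad D i u).const_sub c
  have hneg : ∀ A : Vec d →L[ℝ] Vec d, |(-A).det| = |A.det| := fun A => by
    have : ((-A : Vec d →L[ℝ] Vec d) : Vec d →ₗ[ℝ] Vec d) = (-1 : ℝ) • (A : Vec d →ₗ[ℝ] Vec d) := by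
      ext1 v; simp
    rw [ContinuousLinearMap.det, this, LinearMap.det_smul, abs_mul, abs_pow]
    simp [ContinuousLinearMap.det]
  have hr : 0 ≤ P.C / P.B i * c₁ / P.modulus i := by positivity
  refine (noiseLaw_le_of_preimage_eq (hP.α_pos i k).le (by positivity) (hbij D) (hbij D')
    (hder D) (hder D') (r := 1 + P.C / P.B i * c₁ / P.modulus i) (δ := 2 * P.C / P.B i)
    (fun u => ?_) (fun u => ?_) hX (Set.ext hXY)).trans ?_
  · rw [hneg, hneg]
    exact hP.abs_det_shiftedHess_le hD hD' h u
  · calc ‖c - P.shiftedGrad D' i u‖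
        = ‖(c - P.shiftedGrad D i u) + (P.shiftedGrad D i u - P.shiftedGrad D' i u)‖ := by
          congr 1; abel
      _ ≤ _ := (norm_add_le _ _).trans (by gcongr; exact hP.norm_shiftedGrad_sub_le hD hD' h u)
  · refine mul_le_mul_left (ENNReal.ofReal_le_ofReal ?_) _
    calc (1 + P.C / P.B i * c₁ / P.modulus i) * Real.exp (P.α i k * (2 * P.C / P.B i))
        ≤ Real.exp (P.C / P.B i * c₁ / P.modulus i) * Real.exp (P.α i k * (2 * P.C / P.B i)) := by
          gcongr
          linarith [Real.add_one_le_exp (P.C / P.B i * c₁ / P.modulus i)]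
      _ ≤ _ := by
          rw [← Real.exp_add, Real.exp_le_exp, roundLoss]
          -- From 1 + x ≤ exp x the Jacobian costs only x = C c₁/(B_i m), while the stated loss
          -- provides 2 · 1.4 = 2.8 times x.
          have : 2 * P.C / P.B i * (1.4 * c₁ / P.modulus i + P.α i k)
            = 2.8 * (P.C / P.B i * c₁ / P.modulus i) + P.α i k * (2 * P.C / P.B i) := by ring
          rw [this]
          linarith

/-- Before round m the inputs agree. In round m the odd state is a function of the common primal
variables and the previous state, and the even step follows by `evenStep_oddStep_congr`. Later
rounds again have equal data and noise. -/
lemma hybridState_congr {D D' : ℕ → Dataset d P.B} {f₀ : Fin N → Vec d}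
    {e e' : ℕ → Fin N → Vec d} {m : ℕ} (hD : ∀ k ≠ m, D k = D' k) (he : ∀ k ≠ m, e k = e' k)
    (h : P.oddPrimal (D m) (e m) (P.hybridState D f₀ e (2 * m))
      = P.oddPrimal (D' m) (e' m) (P.hybridState D f₀ e (2 * m))) (t : ℕ) :
    P.hybridState D f₀ e t = P.hybridState D' f₀ e' t := by
  have hlt : ∀ {t}, t ≤ 2 * m → P.hybridState D f₀ e t = P.hybridState D' f₀ e' t :=
    hybridState_congr_of_lt (fun k hk => hD k hk.ne) (fun k hk => he k hk.ne)
  induction t with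
  | zero => rfl
  | succ t ih =>
    by_cases hk : t / 2 = m
    · rcases Nat.even_or_odd' t with ⟨k, rfl | rfl⟩
      · obtain rfl : k = m := by omega
        simp only [hybridState, even_two_mul, if_true, hk, ← hlt le_rfl, oddStep, h]
      · obtain rfl : k = m := by omega
        have : ¬ Even (2 * k + 1) := by simp
        simp only [hybridState, this, even_two_mul, if_true, if_false, hk,
          Nat.mul_div_cancel_left k two_pos, ← hlt le_rfl]
        exact hP.evenStep_oddStep_congr h
    · rw [hybridState, hybridState, ih, hD _ hk, he _ hk]

lemma continuous_oddStep_comp (D : Dataset d P.B) {X : Type*} [TopologicalSpace X]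
    {e : X → Fin N → Vec d} {s : X → State N d} (he : Continuous e) (hs : Continuous s) :
    Continuous fun x => P.oddStep D (e x) (s x) :=
  (hP.continuous_oddStep D).comp (f := fun x => (e x, s x)) (he.prodMk hs)

lemma continuous_evenStep_comp (D : Dataset d P.B) {X : Type*} [TopologicalSpace X]
    {e : X → Fin N → Vec d} {s : X → State N d} (he : Continuous e) (hs : Continuous s) :
    Continuous fun x => P.evenStep D (e x) (s x) :=
  (hP.continuous_evenStep D).comp (f := fun x => (e x, s x)) (he.prodMk hs)

lemma continuous_hybridState (D : ℕ → Dataset d P.B) (t : ℕ) :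
    Continuous fun p : (Fin N → Vec d) × (ℕ → Fin N → Vec d) => P.hybridState D p.1 p.2 t := by
  induction t with
  | zero => exact continuous_fst.prodMk continuous_const
  | succ t ih =>
    have he : Continuous fun p : (Fin N → Vec d) × (ℕ → Fin N → Vec d) => p.2 (t / 2) := by
      fun_prop
    simp only [hybridState]
    split_ifs
    · exact hP.continuous_oddStep_comp _ he ih
    · exact hP.continuous_evenStep_comp _ he ih

lemma measurable_hybridOutput (D : ℕ → Dataset d P.B) : Measurable (P.hybridOutput D) := by
  have hext : Continuous fun w : Fin K → Fin N → Vec d => extendNoise w := by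
    refine continuous_pi fun k => ?_
    unfold extendNoise
    split_ifs <;> fun_prop
  refine Continuous.measurable (continuous_pi fun t => continuous_fst.comp ((hP.continuous_hybridState D t).comp
    (continuous_fst.prodMk (hext.comp continuous_snd))))

/-- The output laws of two hybrids that differ in one sample of one round. -/
lemma map_hybridOutput_le (μ₀ : Measure (Fin N → Vec d)) [IsProbabilityMeasure μ₀]
    {D D' : ℕ → Dataset d P.B} {m : Fin K} (hDD' : ∀ k ≠ (m : ℕ), D k = D' k)
    (hD : D m ∈ Normalized P.B) (hD' : D' m ∈ Normalized P.B) {i : Fin N} {n₀ : Fin (P.B i)}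
    (hi : ∀ j ≠ i, D m j = D' m j) (hn : ∀ n ≠ n₀, D m i n = D' m i n)
    {S : Set (Fin (2 * K + 1) → Fin N → Vec d)} (hS : MeasurableSet S) :
    (P.randomness μ₀).map (P.hybridOutput D) S
      ≤ ENNReal.ofReal (Real.exp (P.roundLoss c₁ i m))
        * (P.randomness μ₀).map (P.hybridOutput D') S := by
  have hprob : ∀ k i, IsProbabilityMeasure (noiseLaw d (P.α i k)) := fun k i =>
    isProbabilityMeasure_noiseLaw d (hP.α_pos i k)
  have hmeas := hP.measurable_hybridOutput D hS
  have hmeas' := hP.measurable_hybridOutput D' hS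
  rw [Measure.map_apply (hP.measurable_hybridOutput D) hS,
    Measure.map_apply (hP.measurable_hybridOutput D') hS, randomness,
    Measure.prod_apply hmeas, Measure.prod_apply hmeas',
    ← lintegral_const_mul' _ _ ENNReal.ofReal_ne_top]
  -- From here on the initial vectors and all noise except that of node i in round m are fixed.
  refine lintegral_mono fun f₀ => ?_
  refine pi_pi_le_of_update (fun k i => noiseLaw d (P.α i k)) m i
    (measurable_prodMk_left hmeas) (measurable_prodMk_left hmeas') _ fun w => ?_
  set upd : Vec d → Fin K → Fin N → Vec d := fun x =>
    Function.update w m (Function.update (w m) i x) with hupd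
  have hext : ∀ x, ∀ k ≠ (m : ℕ), extendNoise (upd x) k = extendNoise w k := fun x k hk => by
    unfold extendNoise
    split_ifs with hkK
    · exact Function.update_of_ne (fun h => hk (congrArg Fin.val h)) _ _
    · rfl
  have hextm : ∀ x, extendNoise (upd x) m = Function.update (w m) i x := fun x => by
    simp [extendNoise, hupd]
  set s := P.hybridState D f₀ (extendNoise w) (2 * m) with hs
  have hstate : ∀ x, P.hybridState D f₀ (extendNoise (upd x)) (2 * m) = s := fun x =>
    hybridState_congr_of_lt (fun _ _ => rfl) (fun k hk => hext x k hk.ne) le_rfl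
  -- The target is computed from the state before round m, which depends neither on the varied noise
  -- nor on which of the two hybrids is run.
  refine hP.noiseLaw_le hD hD' hn m (P.target i s.1 (s.2 i))
    (((measurable_update w).comp (measurable_update (w m)))
      (measurable_prodMk_left hmeas)) fun u => ?_
  have hout : P.hybridOutput D (f₀, upd (P.target i s.1 (s.2 i) - P.shiftedGrad (D m) i u))
      = P.hybridOutput D' (f₀, upd (P.target i s.1 (s.2 i) - P.shiftedGrad (D' m) i u)) := by
    funext t
    refine congrArg Prod.fst (hP.hybridState_congr hDD'
      (fun k hk => (hext _ k hk).trans (hext _ k hk).symm) ?_ t)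
    rw [hstate, hextm, hextm]
    funext j
    by_cases hj : j = i
    · subst hj
      rw [(hP.oddPrimal_eq_iff _ _ _ _ u).2 (by simp), (hP.oddPrimal_eq_iff _ _ _ _ u).2 (by simp)]
    -- Every other node has the same data in both hybrids and keeps its noise.
    · have hobj : P.localObj (D m) j = P.localObj (D' m) j := by
        funext v
        rw [localObj, localObj, hi j hj]
      have hpriv : P.privObj (D m) j = P.privObj (D' m) j := by
        funext f l e v
        rw [privObj, privObj, hobj]
      simp only [oddPrimal, Function.update_of_ne hj, hpriv]
  simp only [Set.mem_ofPred_eq, Set.mem_preimage]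
  exact iff_of_eq (congrArg (· ∈ S) hout)

end Regular

/-! ### Exchanging the dataset round by round -/

open scoped Classical in
/-- The dataset `D` in the rounds of `T`, and `D'` in all others. -/
def mixture (D D' : Dataset d P.B) (T : Finset (Fin K)) (k : ℕ) : Dataset d P.B :=
  if ∃ j ∈ T, (j : ℕ) = k then D else D'

lemma mixture_univ (D D' : Dataset d P.B) :
    P.hybridOutput (mixture D D' Finset.univ) = P.output D := by
  rw [← hybridOutput_const]
  funext ω t
  -- From index K on the mixture is D' instead of D, but 2K iterations use only the rounds below K.
  refine congrArg Prod.fst (hybridState_congr_of_lt (m := K) (fun k hk => ?_) (fun _ _ => rfl)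
    (by omega))
  exact if_pos ⟨⟨k, hk⟩, Finset.mem_univ _, rfl⟩

/-- Induction on T: inserting a round changes the hybrid in that round only and multiplies the bound
by the exponential of its loss. -/
lemma Regular.map_mixture_le {c₁ : ℝ} (hP : P.Regular c₁) (μ₀ : Measure (Fin N → Vec d))
    [IsProbabilityMeasure μ₀] {D D' : Dataset d P.B} (hD : D ∈ Normalized P.B)
    (hD' : D' ∈ Normalized P.B) {i : Fin N} {n₀ : Fin (P.B i)}
    (hi : ∀ j ≠ i, D j = D' j) (hn : ∀ n ≠ n₀, D i n = D' i n)
    {S : Set (Fin (2 * K + 1) → Fin N → Vec d)} (hS : MeasurableSet S) (T : Finset (Fin K)) :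
    (P.randomness μ₀).map (P.hybridOutput (mixture D D' T)) S
      ≤ ENNReal.ofReal (Real.exp (∑ k ∈ T, P.roundLoss c₁ i k)) * P.outputLaw μ₀ D' S := by
  induction T using Finset.induction_on with
  | empty =>
    have : mixture D D' (∅ : Finset (Fin K)) = fun _ => D' := by funext k; simp [mixture]
    rw [this, hybridOutput_const]
    simp [outputLaw]
  | insert m T hm ih =>
    have hin : mixture D D' (insert m T) m = D := if_pos ⟨m, Finset.mem_insert_self _ _, rfl⟩
    have hout : mixture D D' T m = D' := if_neg fun ⟨j, hj, hjm⟩ => hm (Fin.ext hjm ▸ hj)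
    have hne : ∀ k ≠ (m : ℕ), mixture D D' (insert m T) k = mixture D D' T k := fun k hk => by
      have : ¬ (m : ℕ) = k := fun h => hk h.symm
      simp [mixture, this]
    refine (hP.map_hybridOutput_le μ₀ hne (by rwa [hin]) (by rwa [hout])
      (by rwa [hin, hout]) (n₀ := n₀) (by rwa [hin, hout]) hS).trans ?_
    rw [Finset.sum_insert hm, Real.exp_add, ENNReal.ofReal_mul (Real.exp_pos _).le, mul_assoc]
    exact mul_le_mul_right ih _

end Setup

lemma Neighboring.exists_eq_of_ne {N d : ℕ} {B : Fin N → ℕ} {D D' : Dataset d B}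
    (h : Neighboring D D') (hN : 0 < N) (hB : ∀ i, 0 < B i) :
    ∃ i, ∃ n₀ : Fin (B i), (∀ j ≠ i, D j = D' j) ∧ ∀ n ≠ n₀, D i n = D' i n := by
  -- For equal datasets any node and any sample will do, which is why both must exist.
  by_cases heq : D = D'
  · subst heq
    exact ⟨⟨0, hN⟩, ⟨0, hB _⟩, fun _ _ => rfl, fun _ _ => rfl⟩
  obtain ⟨i, hi⟩ := Function.ne_iff.1 heq
  obtain ⟨n₀, hn₀⟩ := Function.ne_iff.1 hi
  refine ⟨i, n₀, fun j hj => ?_, fun n hn => ?_⟩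
  · funext n
    by_contra hne
    exact hj (congrArg Sigma.fst (h (x := ⟨j, n⟩) hne (y := ⟨i, n₀⟩) hn₀))
  · by_contra hne
    exact hn (eq_of_heq (Sigma.mk.inj (h (x := ⟨i, n⟩) hne (y := ⟨i, n₀⟩) hn₀)).2)

end PrivateRADMM
end

theorem theorem2 {N d K : ℕ} (P : PrivateRADMM.Setup N d K)
    (hG : P.graph.Connected)
    (hC : 0 < P.C) (hCB : ∀ i, P.C ≤ P.B i) (hρ : 0 < P.ρ) (hη : 0 < P.η) (hγ : 0 ≤ P.γ)
    (hstep : ∀ i, 0 < 2 * P.η * P.V i + P.γ)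
    (hα : ∀ i k, 0 < P.α i k)
    (c₁ : ℝ)
    (hL : StrictConvexOn ℝ Set.univ P.L)
    (hL₁ : Differentiable ℝ P.L) (hL₂ : Differentiable ℝ (deriv P.L))
    (hL' : ∀ z, |deriv P.L z| ≤ 1)
    (hL'' : ∀ z, 0 < deriv (deriv P.L) z ∧ deriv (deriv P.L) z ≤ c₁)
    (hR : StrongConvexOn Set.univ 1 P.R) (hR₂ : ContDiff ℝ 2 P.R)
    (hcond : ∀ i, 2 * c₁ < P.B i / P.C * (P.ρ / N + 2 * P.η * P.V i))
    (μ₀ : MeasureTheory.Measure (Fin N → PrivateRADMM.Vec d))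
    [MeasureTheory.IsProbabilityMeasure μ₀]
    (β : ℝ)
    (hβ : ∀ i, ∑ k : Fin K, 2 * P.C / P.B i *
      (1.4 * c₁ / (P.ρ / N + 2 * P.η * P.V i) + P.α i k) ≤ β) :
    -- each perturbed objective has exactly one minimizer, so the odd updates are well defined
    (∀ D ∈ PrivateRADMM.Normalized P.B, ∀ i f l e,
      ∃! u, ∀ w, P.privObj D i f l e u ≤ P.privObj D i f l e w) ∧
    -- the output of the algorithm is a random variable
    (∀ D ∈ PrivateRADMM.Normalized P.B, Measurable (P.output D) ∧
      MeasureTheory.IsProbabilityMeasure (P.outputLaw μ₀ D)) ∧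
    -- its law is differentially private
    PrivateRADMM.DifferentiallyPrivate (PrivateRADMM.Normalized P.B) PrivateRADMM.Neighboring
      (P.outputLaw μ₀) β := by
  have hN : 0 < N := Fin.pos_iff_nonempty.2 hG.nonempty
  have hP : P.Regular c₁ := ⟨hN, hC, hCB, hρ, hη, hα, hL, hL₁, hL₂, hL', hL'', hR, hR₂⟩
  have hmeas : ∀ D, Measurable (P.output D) := fun D => by
    rw [← PrivateRADMM.Setup.hybridOutput_const]
    exact hP.measurable_hybridOutput _
  refine ⟨fun D _ i f l e => hP.existsUnique_minimizer D i f l e, fun D _ => ⟨hmeas D, ?_⟩, ?_⟩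
  · have : ∀ k i, MeasureTheory.IsProbabilityMeasure (PrivateRADMM.noiseLaw d (P.α i k)) :=
      fun k i => PrivateRADMM.isProbabilityMeasure_noiseLaw d (hα i k)
    have : MeasureTheory.IsProbabilityMeasure (P.randomness μ₀) := by
      unfold PrivateRADMM.Setup.randomness
      infer_instance
    exact MeasureTheory.Measure.isProbabilityMeasure_map (hmeas D).aemeasurable
  · intro D hD D' hD' hDD' S hS
    obtain ⟨i, n₀, hi, hn⟩ := hDD'.exists_eq_of_ne hN fun i => by exact_mod_cast hP.B_pos i
    have h := hP.map_mixture_le μ₀ hD hD' hi hn hS Finset.univ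
    rw [PrivateRADMM.Setup.mixture_univ] at h
    refine h.trans ?_
    gcongr
    exact hβ i
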